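/- Let $\mathfrak u$ be a non-principal ultrafilter on $\mathbb N$, let ${}^*\mathbb R$ be the corresponding ultrapower of $\mathbb R$, and let ${}^\star\mathbb P\mathbb R$ be the quotient of $\{x\in{}^*\mathbb R : x\ge 0\}$ by multiplication by positive finite non-infinitesimal hyperreals, with the induced product and order, with tropical addition $\mu+\nu:=\max(\mu,\nu)$, with powers $\langle x\rangle^{r}:=\langle x^{r}\rangle$ for finite hyperreal $r\ge 0$ and $x\ge 0$ (with $0^0=1$), where $\langle x\rangle$ denotes the class of $|x|$, and with $-\infty:=\langle 0\rangle$ its least element. Let ${}^\star\mathbb P\mathbb R_\varepsilon$ be the set of classes of infinitesimals (including $-\infty$). Elements of ${}^*\mathbb R$ act on ${}^\star\mathbb P\mathbb R$ by $x\cdot\mu:=\langle x\rangle\cdot\mu$. For $\theta\in\mathbb R$ and a positive, possibly infinite, hypernatural number $d$, let ${}^*\tilde Z(\theta)_d$ be the set of $f={}^*\{f_i\}$ in the ultrapower ${}^*(\mathbb Z[X])$ with $\deg f\le d$ and $f(\theta)$ infinitesimal. Put $\mathfrak h_d(f)=\mathfrak h(f)^{1/d}$ and $\mathfrak m_d(f)=\mathfrak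 m(f)^{1/d}$, where $\mathfrak h$ is the height (the largest absolute value of a coefficient) and $\mathfrak m$ is the Mahler measure; put $\mu_d(f)=\langle \mathfrak h_d(f)^{-1}\rangle$ for $f\neq 0$, and $\nu_d(f)=\langle |f(\theta)|^{1/d}\rangle$ for $f\in{}^*\tilde Z(\theta)_d$. For non-zero standard polynomials $f=a\prod_{i=1}^m(X-\alpha_i)$, $g=b\prod_{j=1}^n(X-\beta_j)$ in $\mathbb Z[X]$ let $f\diamond_\times g=a^n b^m\prod_{i,j}(X-\alpha_i\beta_j)\in\mathbb Z[X]$ be the resultant product, set $f\diamond_\times g=0$ if $f=0$ or $g=0$, and extend $\diamond_\times$ termwise to ${}^*(\mathbb Z[X])$. For $\mu,\kappa\in{}^\star\mathbb P\mathbb R$ and a positive hypernatural number $e$ let $${}^*\tilde Z^{\mu}(\theta)_d=\{f\in{}^*\tilde Z(\theta)_d : f=0\text{ or }\mu_d(f)>\mu\},\qquad {}^*\tilde Z^{\mu}_{\kappa^{e}}(\theta)_d=\{f\in{}^*\tilde Z^{\mu}(\theta)_d : \nu_d(f)^{1/e}\le\kappa\}.$$ Theorem. Let $\theta,\eta\in\mathbb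 R$ and let $d,e$ be positive hypernatural numbers. For all $f\in{}^*\tilde Z(\theta)_d$ and $g\in{}^*\tilde Z(\eta)_e$, with $\nu_{de}(f\diamond_\times g)$ computed at $\theta\eta$, $$\nu_{de}(f\diamond_\times g)\;\le\;\Bigl(\mathfrak m_d(f)^{1-1/e}\,\mathfrak m_e(g)\cdot\nu_d(f)^{1/e}\Bigr)+\Bigl(\mathfrak m_d(f)\,\mathfrak m_e(g)^{1-1/d}\cdot\nu_e(g)^{1/d}\Bigr).$$ Moreover, for all $\mu,\nu\in{}^\star\mathbb P\mathbb R_\varepsilon$, the product $\diamond_\times$ restricts to a well-defined map $${}^*\tilde Z^{\mu}_{(\mu^{1-1/e}\cdot\nu)^{e}}(\theta)_d\times{}^*\tilde Z^{\nu}_{(\mu\cdot\nu^{1-1/d})^{d}}(\eta)_e\longrightarrow{}^*\tilde Z^{\mu\cdot\nu}(\theta\eta)_{de}.$$ -/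

import Mathlib

open Polynomial Filter

noncomputable section

namespace Ideology

/-! ### Hyperreals and the growth-decay semi-ring -/

/-- The hyperreals: the ultrapower of `ℝ` along an ultrafilter on `ℕ`. -/
abbrev Hyper (U : Ultrafilter ℕ) : Type := Germ (U : Filter ℕ) ℝ

/-- A standard real viewed as a hyperreal. -/
def std (U : Ultrafilter ℕ) (r : ℝ) : Hyper U := ((r : ℝ) : Germ (U : Filter ℕ) ℝ)

lemma std_le_std {U : Ultrafilter ℕ} {a b : ℝ} (h : a ≤ b) : std U a ≤ std U b :=
  Germ.const_le h

/-- A hyperreal is finite if it is bounded in absolute value by a standard real. -/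
def IsFinite {U : Ultrafilter ℕ} (x : Hyper U) : Prop := ∃ C : ℝ, |x| ≤ std U C

/-- A hyperreal is infinitesimal if its absolute value is below every positive standard real. -/
def IsInfinitesimal {U : Ultrafilter ℕ} (x : Hyper U) : Prop :=
  ∀ ε : ℝ, 0 < ε → |x| < std U ε

/-- The valuation ring of finite hyperreals. -/
def finiteHyper (U : Ultrafilter ℕ) : ValuationSubring (Hyper U) where
  carrier := {x | IsFinite x}
  mul_mem' := by
    rintro x y ⟨A, hA⟩ ⟨B, hB⟩
    refine ⟨A * B, ?_⟩
    rw [abs_mul]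
    exact mul_le_mul hA hB (abs_nonneg _) ((abs_nonneg _).trans hA)
  one_mem' := ⟨1, by rw [abs_one]; exact le_refl _⟩
  add_mem' := by
    rintro x y ⟨A, hA⟩ ⟨B, hB⟩
    exact ⟨A + B, (abs_add_le x y).trans (add_le_add hA hB)⟩
  zero_mem' := ⟨0, by rw [abs_zero]; exact le_refl _⟩
  neg_mem' := by
    rintro x ⟨A, hA⟩
    exact ⟨A, by rwa [abs_neg]⟩
  mem_or_inv_mem' := by
    intro x
    have h1 : (1 : Hyper U) = std U 1 := rfl
    rcases le_total |x| 1 with h | h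
    · exact Or.inl ⟨1, h.trans h1.le⟩
    · exact Or.inr ⟨1, by rw [abs_inv]; exact (inv_le_one_of_one_le₀ h).trans h1.le⟩

/-- The growth-decay semi-ring: the quotient of the hyperreals by the multiplicative group of
units of the ring of finite hyperreals. As `-1` is such a unit, this is also the quotient of the
nonnegative hyperreals by the positive units. Multiplication and order are induced from the
hyperreals, tropical addition is `max`, and the class `0` of `0` is the element usually written
`-∞`. -/
abbrev GrowthDecay (U : Ultrafilter ℕ) : Type := (finiteHyper U).ValueGroup

/-- The class `⟨x⟩` of a hyperreal in the growth-decay semi-ring. -/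
def cls {U : Ultrafilter ℕ} (x : Hyper U) : GrowthDecay U := (finiteHyper U).valuation x

/-- The decay semi-ring: the classes of infinitesimals (including the class of `0`). -/
def decaySemiring (U : Ultrafilter ℕ) : Set (GrowthDecay U) :=
  {μ | ∃ x : Hyper U, IsInfinitesimal x ∧ cls x = μ}

/-! ### Powers -/

/-- The power `|x| ^ r` of hyperreals, computed termwise. -/
def hpow {U : Ultrafilter ℕ} (x r : Hyper U) : Hyper U :=
  Germ.map₂ (fun a b : ℝ => |a| ^ b) x r

/-- The exponents that act on the growth-decay semi-ring: finite nonnegative hyperreals. -/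
def Exponent (U : Ultrafilter ℕ) : Type := {r : Hyper U // 0 ≤ r ∧ IsFinite r}

lemma hpow_mul {U : Ultrafilter ℕ} (x y r : Hyper U) :
    hpow (x * y) r = hpow x r * hpow y r := by
  induction x using Germ.inductionOn with | _ x
  induction y using Germ.inductionOn with | _ y
  induction r using Germ.inductionOn with | _ r
  refine Germ.coe_eq.2 (Eventually.of_forall fun i => ?_)
  simp only [abs_mul]
  exact Real.mul_rpow (abs_nonneg _) (abs_nonneg _)

lemma one_hpow {U : Ultrafilter ℕ} (r : Hyper U) : hpow 1 r = 1 := by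
  induction r using Germ.inductionOn with | _ r
  refine Germ.coe_eq.2 (Eventually.of_forall fun i => ?_)
  simp

lemma hpow_isFinite {U : Ultrafilter ℕ} {x : Hyper U} (hx : IsFinite x) (r : Exponent U) :
    IsFinite (hpow x r.1) := by
  obtain ⟨r, hr0, R, hR⟩ := r
  obtain ⟨C, hC⟩ := hx
  refine ⟨(max C 1) ^ R, ?_⟩
  induction x using Germ.inductionOn with | _ x
  induction r using Germ.inductionOn with | _ r
  have hC' : ∀ᶠ i in (U : Filter ℕ), |x i| ≤ C := Germ.coe_le.1 hC
  have hR' : ∀ᶠ i in (U : Filter ℕ), |r i| ≤ R := Germ.coe_le.1 hR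
  have hr0' : ∀ᶠ i in (U : Filter ℕ), 0 ≤ r i := Germ.coe_nonneg.1 hr0
  refine Germ.coe_le.2 ?_
  filter_upwards [hC', hR', hr0'] with i h1 h2 h3
  change |(|x i| ^ r i)| ≤ (max C 1) ^ R
  rw [abs_of_nonneg (Real.rpow_nonneg (abs_nonneg _) _)]
  calc |x i| ^ r i ≤ (max C 1) ^ r i :=
        Real.rpow_le_rpow (abs_nonneg _) (h1.trans (le_max_left _ _)) h3
    _ ≤ (max C 1) ^ R :=
        Real.rpow_le_rpow_of_exponent_le (le_max_right _ _) ((le_abs_self _).trans h2)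

lemma cls_hpow_unit {U : Ultrafilter ℕ} (a : (finiteHyper U)ˣ) (r : Exponent U) :
    cls (hpow ((a : finiteHyper U) : Hyper U) r.1) = 1 := by
  have h1 : cls (hpow ((a : finiteHyper U) : Hyper U) r.1) ≤ 1 :=
    ((finiteHyper U).valuation_le_one_iff _).2 (hpow_isFinite (a : finiteHyper U).2 r)
  have h2 : cls (hpow (((a⁻¹ : (finiteHyper U)ˣ) : finiteHyper U) : Hyper U) r.1) ≤ 1 :=
    ((finiteHyper U).valuation_le_one_iff _).2
      (hpow_isFinite ((a⁻¹ : (finiteHyper U)ˣ) : finiteHyper U).2 r)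
  have h3 : cls (hpow ((a : finiteHyper U) : Hyper U) r.1) *
      cls (hpow (((a⁻¹ : (finiteHyper U)ˣ) : finiteHyper U) : Hyper U) r.1) = 1 := by
    have h4 : ((a : finiteHyper U) : Hyper U) *
        (((a⁻¹ : (finiteHyper U)ˣ) : finiteHyper U) : Hyper U) = 1 :=
      congrArg Subtype.val (Units.mul_inv a)
    unfold cls
    rw [← map_mul, ← hpow_mul, h4, one_hpow, map_one]
  refine le_antisymm h1 ?_
  calc (1 : GrowthDecay U) = _ := h3.symm
    _ ≤ cls (hpow ((a : finiteHyper U) : Hyper U) r.1) * 1 := mul_le_mul_right h2 _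
    _ = _ := mul_one _

lemma cls_hpow_eq {U : Ultrafilter ℕ} (r : Exponent U) {x y : Hyper U} (h : cls x = cls y) :
    cls (hpow x r.1) = cls (hpow y r.1) := by
  obtain ⟨a, rfl⟩ := ((finiteHyper U).valuation_eq_iff _ _).1 h
  rw [hpow_mul]
  unfold cls
  rw [map_mul]
  have := cls_hpow_unit a r
  unfold cls at this
  rw [this, one_mul]

/-- The Frobenius action of finite nonnegative exponents on the growth-decay semi-ring,
`⟨x⟩ ^ r = ⟨x ^ r⟩`. -/
def GrowthDecay.pow {U : Ultrafilter ℕ} (μ : GrowthDecay U) (r : Exponent U) : GrowthDecay U :=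
  Quotient.liftOn' μ (fun x => cls (hpow x r.1)) fun _ _ h =>
    cls_hpow_eq r (Quotient.sound' (s₁ := MulAction.orbitRel (finiteHyper U)ˣ (Hyper U)) h)

lemma cls_pow {U : Ultrafilter ℕ} (x : Hyper U) (r : Exponent U) :
    GrowthDecay.pow (cls x) r = cls (hpow x r.1) := rfl

/-- A degree bound: a positive hypernatural number, possibly infinite. -/
abbrev HyperDeg (U : Ultrafilter ℕ) : Type := Germ (U : Filter ℕ) ℕ+

/-- The hyperreal `1 / d`. -/
def recip {U : Ultrafilter ℕ} (d : HyperDeg U) : Hyper U :=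
  Germ.map (fun n : ℕ+ => ((n : ℕ) : ℝ)⁻¹) d

lemma recip_nonneg {U : Ultrafilter ℕ} (d : HyperDeg U) : 0 ≤ recip d := by
  induction d using Germ.inductionOn with | _ d
  exact Germ.coe_nonneg.2 (Eventually.of_forall fun i => by simp)

lemma recip_le_one {U : Ultrafilter ℕ} (d : HyperDeg U) : recip d ≤ 1 := by
  induction d using Germ.inductionOn with | _ d
  refine Germ.coe_le.2 (Eventually.of_forall fun i => ?_)
  exact inv_le_one_of_one_le₀ (by exact_mod_cast (d i).pos)

/-- The exponent `1 / d`. -/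
def invExp {U : Ultrafilter ℕ} (d : HyperDeg U) : Exponent U :=
  ⟨recip d, recip_nonneg d, 1, by rw [abs_of_nonneg (recip_nonneg d)]; exact recip_le_one d⟩

/-- The exponent `1 - 1 / d`. -/
def oneSubInvExp {U : Ultrafilter ℕ} (d : HyperDeg U) : Exponent U :=
  ⟨1 - recip d, sub_nonneg.2 (recip_le_one d), 1, by
    rw [abs_of_nonneg (sub_nonneg.2 (recip_le_one d))]
    exact sub_le_self _ (recip_nonneg d)⟩

/-! ### Hyperpolynomials -/

/-- The ring of integral polynomials of possibly infinite degree: the ultrapower of `ℤ[X]`. -/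
abbrev HyperPoly (U : Ultrafilter ℕ) : Type := Germ (U : Filter ℕ) ℤ[X]

/-- `deg f ≤ d`. -/
def DegLE {U : Ultrafilter ℕ} (f : HyperPoly U) (d : HyperDeg U) : Prop :=
  Germ.map natDegree f ≤ Germ.map (fun n : ℕ+ => (n : ℕ)) d

/-- The value `f(θ)` at a standard real. -/
def hyperEval {U : Ultrafilter ℕ} (θ : ℝ) (f : HyperPoly U) : Hyper U :=
  Germ.map (fun p : ℤ[X] => aeval θ p) f

/-- The height of an integral polynomial: the maximum of the absolute values of its coefficients. -/
def height (p : ℤ[X]) : ℕ := p.support.sup fun i => (p.coeff i).natAbs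

/-- The degree-normalized height `𝔥(f) ^ (1 / d)`. -/
def normHeight {U : Ultrafilter ℕ} (d : HyperDeg U) (f : HyperPoly U) : Hyper U :=
  hpow (Germ.map (fun p : ℤ[X] => (height p : ℝ)) f) (recip d)

/-- The degree-normalized Mahler measure `𝔪(f) ^ (1 / d)`. -/
def normMahler {U : Ultrafilter ℕ} (d : HyperDeg U) (f : HyperPoly U) : Hyper U :=
  hpow (Germ.map (fun p : ℤ[X] => p.mapMahlerMeasure (Int.castRingHom ℂ)) f) (recip d)

/-- The degree-normalized growth `⟨𝔥(f) ^ (-1 / d)⟩` (meaningful for `f ≠ 0`). -/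
def growth {U : Ultrafilter ℕ} (d : HyperDeg U) (f : HyperPoly U) : GrowthDecay U :=
  cls (normHeight d f)⁻¹

/-- The degree-normalized decay `⟨|f(θ)| ^ (1 / d)⟩` of `f` at `θ`. -/
def decay {U : Ultrafilter ℕ} (θ : ℝ) (d : HyperDeg U) (f : HyperPoly U) : GrowthDecay U :=
  cls (hpow (hyperEval θ f) (recip d))

/-- The polynomial diophantine approximations of `θ` of degree at most `d`. -/
def approx (U : Ultrafilter ℕ) (θ : ℝ) (d : HyperDeg U) : Set (HyperPoly U) :=
  {f | DegLE f d ∧ IsInfinitesimal (hyperEval θ f)}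

/-- The approximations of `θ` of degree at most `d` whose degree-normalized growth is greater
than `μ`; the zero polynomial is included. -/
def growthSet (θ : ℝ) {U : Ultrafilter ℕ} (d : HyperDeg U) (μ : GrowthDecay U) :
    Set (HyperPoly U) :=
  {f | f ∈ approx U θ d ∧ (f = 0 ∨ μ < growth d f)}

/-- The approximations of `θ` of degree at most `d` with growth index `μ` and decay index
`κ ^ e`, where the possibly undefined power is given meaning by taking `e`-th roots: the decay
condition is `(decay θ d f) ^ (1 / e) ≤ κ`. -/
def growthDecaySet (θ : ℝ) {U : Ultrafilter ℕ} (d : HyperDeg U) (μ : GrowthDecay U)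
    (κ : GrowthDecay U) (e : HyperDeg U) : Set (HyperPoly U) :=
  {f | f ∈ growthSet θ d μ ∧ GrowthDecay.pow (decay θ d f) (invExp e) ≤ κ}

/-! ### The resultant product -/

/-- The complex polynomial `a ^ n * b ^ m * ∏ (X - α_i β_j)`, where `a`, `m`, `α_i` and `b`, `n`,
`β_j` are the leading coefficients, the degrees and the complex roots of `f` and `g`. -/
def rootProduct (f g : ℤ[X]) : ℂ[X] :=
  C ((f.leadingCoeff : ℂ) ^ g.natDegree * (g.leadingCoeff : ℂ) ^ f.natDegree) *
    ((f.map (Int.castRingHom ℂ)).roots.map fun α =>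
      ((g.map (Int.castRingHom ℂ)).roots.map fun β => X - C (α * β)).prod).prod

lemma homogenize_eval (f : ℂ[X]) (z β : ℂ) :
    ∑ i ∈ Finset.range (f.natDegree + 1), f.coeff i * z ^ i * β ^ (f.natDegree - i) =
      f.leadingCoeff * (f.roots.map fun α => z - α * β).prod := by
  have hs : f.Splits := IsAlgClosed.splits f
  have hcard := hs.natDegree_eq_card_roots
  by_cases hβ : β = 0
  · subst hβ
    rw [Finset.sum_range_succ, Finset.sum_eq_zero]
    · simp [← hcard]
    · intro i hi
      rw [Finset.mem_range] at hi
      rw [zero_pow (by omega), mul_zero]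
  · have h1 : ∑ i ∈ Finset.range (f.natDegree + 1), f.coeff i * z ^ i * β ^ (f.natDegree - i) =
        β ^ f.natDegree * f.eval (z / β) := by
      rw [eval_eq_sum_range, Finset.mul_sum]
      refine Finset.sum_congr rfl fun i hi => ?_
      rw [Finset.mem_range] at hi
      have h2 : β ^ f.natDegree = β ^ (f.natDegree - i) * β ^ i := by
        rw [← pow_add]; congr 1; omega
      rw [h2, div_pow]
      field_simp
    rw [h1, hs.eval_eq_prod_roots]
    have h3 : β ^ f.natDegree = (f.roots.map fun _ => β).prod := by
      simp [← hcard]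
    rw [h3, mul_left_comm, ← Multiset.prod_map_mul]
    congr 3
    ext α
    field_simp

/-- The coefficients of the resultant product are integers. -/
theorem exists_resultantProduct (f g : ℤ[X]) :
    ∃ p : ℤ[X], p.map (Int.castRingHom ℂ) = rootProduct f g := by
  set m := f.natDegree with hm
  let F : ℤ[X][X] := ∑ i ∈ Finset.range (m + 1), C (C (f.coeff i) * X ^ i) * X ^ (m - i)
  refine ⟨resultant (g.map C) F g.natDegree m, ?_⟩
  have hinj : Function.Injective (Int.castRingHom ℂ) := Int.cast_injective
  refine Polynomial.funext fun z => ?_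
  set φ : ℤ[X] →+* ℂ := (evalRingHom z).comp (mapRingHom (Int.castRingHom ℂ)) with hφ
  have e1 : eval z ((resultant (g.map C) F g.natDegree m).map (Int.castRingHom ℂ)) =
      φ (resultant (g.map C) F g.natDegree m) := rfl
  have e2 : (g.map (C : ℤ →+* ℤ[X])).map φ = g.map (Int.castRingHom ℂ) := by
    rw [Polynomial.map_map]
    congr 1
    exact RingHom.ext_int _ _
  have e3 : F.map φ = ∑ i ∈ Finset.range (m + 1), C ((f.coeff i : ℂ) * z ^ i) * X ^ (m - i) := by
    simp [F, hφ, Polynomial.map_sum]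
  have e4 : (F.map φ).natDegree ≤ m := by
    rw [e3]
    refine natDegree_sum_le_of_forall_le _ _ fun i _ => ?_
    exact (natDegree_C_mul_X_pow_le _ _).trans (Nat.sub_le _ _)
  have e5 : ∀ β, (F.map φ).eval β = (f.leadingCoeff : ℂ) *
      ((f.map (Int.castRingHom ℂ)).roots.map fun α => z - α * β).prod := by
    intro β
    have := homogenize_eval (f.map (Int.castRingHom ℂ)) z β
    rw [natDegree_map_eq_of_injective hinj, leadingCoeff_map_of_injective hinj] at this
    rw [e3]
    simpa [eval_finsetSum] using this
  have hgs : (g.map (Int.castRingHom ℂ)).Splits := IsAlgClosed.splits _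
  have hdeg : (g.map (Int.castRingHom ℂ)).natDegree = g.natDegree :=
    natDegree_map_eq_of_injective hinj g
  rw [e1, ← resultant_map_map, e2]
  have key := resultant_eq_prod_eval (g.map (Int.castRingHom ℂ)) (F.map φ) m e4 hgs
  rw [hdeg] at key
  rw [key, leadingCoeff_map_of_injective hinj]
  have e6 : ((g.map (Int.castRingHom ℂ)).roots.map (F.map φ).eval).prod =
      (f.leadingCoeff : ℂ) ^ g.natDegree *
        ((g.map (Int.castRingHom ℂ)).roots.map fun β =>
          ((f.map (Int.castRingHom ℂ)).roots.map fun α => z - α * β).prod).prod := by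
    rw [Multiset.map_congr rfl fun β _ => e5 β, Multiset.prod_map_mul]
    congr 1
    rw [Multiset.map_const', Multiset.prod_replicate, ← hgs.natDegree_eq_card_roots, hdeg]
  rw [e6, Multiset.prod_map_prod_map]
  simp only [rootProduct, eval_mul, eval_C, eval_multiset_prod, Multiset.map_map,
    Function.comp_def, eval_sub, eval_X, eq_intCast, ← hm]
  ring

/-- The resultant product of integral polynomials: the integral polynomial
`a ^ n * b ^ m * ∏ (X - α_i β_j)`, extended by `0` if one of the factors is the zero polynomial. -/
def resultantProduct (f g : ℤ[X]) : ℤ[X] :=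
  open Classical in
  if f = 0 ∨ g = 0 then 0 else (exists_resultantProduct f g).choose

lemma resultantProduct_spec {f g : ℤ[X]} (hf : f ≠ 0) (hg : g ≠ 0) :
    (resultantProduct f g).map (Int.castRingHom ℂ) = rootProduct f g := by
  rw [resultantProduct, if_neg (by tauto)]
  exact (exists_resultantProduct f g).choose_spec

/-- The resultant product of hyperpolynomials, computed termwise. -/
def hyperResultantProduct {U : Ultrafilter ℕ} (f g : HyperPoly U) : HyperPoly U :=
  Germ.map₂ resultantProduct f g

end Ideology

end

open Ideology

namespace Ideology

/-! ### Products of maxima over multisets -/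

/-! Let `α` and `β` run over the complex roots of `f` and `g`, with degrees `m` and `n`. Up to
leading coefficients, the value of the resultant product at `θη` is the product of all `θη - αβ = (θ
- α)β + θ(η - β)`. Hence each factor is at most `K · max 1 |α| · max 1 |β| · max A_α B_β`, where `K`
depends only on `θ, η` and `A_α, B_β ∈ [0, 1]` are normalized distances from `α` to `θ` and from `β`
to `η` (`norm_mul_sub_mul_le`).

The double product of the maxima is at most `max (∏ A_α) (∏ B_β)` (`prod_prod_max_le`), while `∏ A_α
≤ |f(θ)| / 𝔪(f)` and similarly for `g`. Together these give `abs_aeval_resultantProduct_le`: the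
value is at most `K^(mn) 𝔪(f)^n 𝔪(g)^m max (|f(θ)|/𝔪(f)) (|g(η)|/𝔪(g))`. Mahler measures of nonzero
integral polynomials are at least 1, so `m, n` may be raised to `d, e`. The `de`-th root then turns
`K^(de)` into the standard constant `K`, which classes do not see; this is the first claim.

For the second claim, height and Mahler measure differ by factors of at most `2^deg`, again
invisible after normalization, and `𝔪(f ⋄ g) ≤ 𝔪(f)^n 𝔪(g)^m`. The growth conditions give `𝔪_d(f)·μ
< 1` and `𝔪_e(g)·ν < 1`. Inserted into the first claim, the decay conditions leave products of
powers of these two quantities, so the class of the `de`-th root of the value is below 1 and the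
value is infinitesimal. -/

lemma prod_map_le_of_mem {ι : Type*} {t : Multiset ι} {h : ι → ℝ} {b : ι} (hb : b ∈ t)
    (h0 : ∀ x, 0 ≤ h x) (h1 : ∀ x, h x ≤ 1) : (t.map h).prod ≤ h b := by
  obtain ⟨t', rfl⟩ := Multiset.exists_cons_of_mem hb
  rw [Multiset.map_cons, Multiset.prod_cons]
  refine mul_le_of_le_one_right (h0 b) ?_
  simpa using Multiset.prod_map_le_prod_map₀ (s := t') h (fun _ => (1 : ℝ)) (fun x _ => h0 x)
    (fun x _ => h1 x)

/-- In each inner product only the factor at `b` is kept, the others being at most 1; there the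
maximum is `A x`, because `B b` lies below every `A x`. -/
lemma prod_prod_max_le_left {ι κ : Type*} {s : Multiset ι} {t : Multiset κ} {A : ι → ℝ}
    {B : κ → ℝ} (hA0 : ∀ x, 0 ≤ A x) (hA1 : ∀ x, A x ≤ 1) (hB1 : ∀ y, B y ≤ 1) {b : κ}
    (hb : b ∈ t) (hmin : ∀ x ∈ s, B b ≤ A x) :
    (s.map fun x => (t.map fun y => max (A x) (B y)).prod).prod ≤ (s.map A).prod := by
  refine Multiset.prod_map_le_prod_map₀ _ _
    (fun x _ => Multiset.prod_nonneg fun z hz => ?_) fun x hx => ?_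
  · obtain ⟨y, -, rfl⟩ := Multiset.mem_map.1 hz
    exact (hA0 x).trans (le_max_left _ _)
  · exact (prod_map_le_of_mem hb (fun y => (hA0 x).trans (le_max_left _ _))
      fun y => max_le (hA1 x) (hB1 y)).trans (max_le le_rfl (hmin x hx))

lemma exists_mem_forall_le {ι : Type*} {s : Multiset ι} (hs : s ≠ 0) (A : ι → ℝ) :
    ∃ a ∈ s, ∀ x ∈ s, A a ≤ A x := by
  classical
  obtain ⟨a, ha, h⟩ := s.toFinset.exists_min_image A (by simpa using hs)
  exact ⟨a, by simpa using ha, fun x hx => h x (by simpa using hx)⟩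

/-- The side containing the smallest of all the numbers `A x`, `B y` decides: if it is some `B b`,
the bound is the product of the `A x`, and symmetrically. An empty side makes both products equal to
1 at once. -/
lemma prod_prod_max_le {ι κ : Type*} (s : Multiset ι) (t : Multiset κ) {A : ι → ℝ}
    {B : κ → ℝ} (hA0 : ∀ x, 0 ≤ A x) (hA1 : ∀ x, A x ≤ 1) (hB0 : ∀ y, 0 ≤ B y)
    (hB1 : ∀ y, B y ≤ 1) :
    (s.map fun x => (t.map fun y => max (A x) (B y)).prod).prod ≤
      max (s.map A).prod (t.map B).prod := by
  rcases eq_or_ne s 0 with rfl | hs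
  · simp
  rcases eq_or_ne t 0 with rfl | ht
  · simp
  obtain ⟨a, ha, hamin⟩ := exists_mem_forall_le hs A
  obtain ⟨b, hb, hbmin⟩ := exists_mem_forall_le ht B
  rcases le_total (B b) (A a) with h | h
  · exact (prod_prod_max_le_left hA0 hA1 hB1 hb fun x hx => h.trans (hamin x hx)).trans
      (le_max_left _ _)
  · refine le_trans ?_ (le_max_right _ _)
    rw [Multiset.prod_map_prod_map]
    simp only [max_comm (A _)]
    exact prod_prod_max_le_left hB0 hB1 hA1 ha fun y hy => h.trans (hbmin y hy)

lemma prod_prod_mul {ι κ : Type*} (s : Multiset ι) (t : Multiset κ) (K : ℝ) (u : ι → ℝ)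
    (v : κ → ℝ) (w : ι → κ → ℝ) :
    (s.map fun x => (t.map fun y => K * u x * v y * w x y).prod).prod =
      K ^ (s.card * t.card) * (s.map u).prod ^ t.card * (t.map v).prod ^ s.card *
        (s.map fun x => (t.map fun y => w x y).prod).prod := by
  simp only [Multiset.prod_map_mul, Multiset.map_const', Multiset.prod_replicate,
    Multiset.prod_map_pow]
  rw [mul_pow, ← pow_mul]

/-! ### Height and Mahler measure of the resultant product -/

/-- The Mahler measure of an integral polynomial. -/
noncomputable abbrev mahler (p : ℤ[X]) : ℝ := p.mapMahlerMeasure (Int.castRingHom ℂ)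

lemma one_le_mahler {p : ℤ[X]} (hp : p ≠ 0) : 1 ≤ mahler p :=
  one_le_mahlerMeasure_of_ne_zero hp

lemma mahler_eq (p : ℤ[X]) :
    mahler p = |(p.leadingCoeff : ℝ)| *
      (((p.map (Int.castRingHom ℂ)).roots.map fun α => max 1 ‖α‖).prod) := by
  rw [mahler, mapMahlerMeasure_eq, mahlerMeasure_eq_leadingCoeff_mul_prod_roots,
    leadingCoeff_map_of_injective (RingHom.injective_int _)]
  simp

lemma card_roots_map_complex (p : ℤ[X]) :
    (p.map (Int.castRingHom ℂ)).roots.card = p.natDegree := by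
  rw [← (IsAlgClosed.splits (p.map (Int.castRingHom ℂ))).natDegree_eq_card_roots,
    natDegree_map_eq_of_injective (RingHom.injective_int _)]

lemma abs_aeval_eq_norm (p : ℤ[X]) (θ : ℝ) :
    |aeval θ p| = ‖(p.map (Int.castRingHom ℂ)).eval (θ : ℂ)‖ := by
  have h : ((aeval θ p : ℝ) : ℂ) = aeval (θ : ℂ) p := by
    simpa using (aeval_algebraMap_apply ℂ θ p).symm
  rw [← Real.norm_eq_abs, ← Complex.norm_real, h, aeval_def, eval_map]
  rfl

lemma norm_multiset_prod (s : Multiset ℂ) : ‖s.prod‖ = (s.map fun z => ‖z‖).prod :=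
  map_multiset_prod (normHom : ℂ →*₀ ℝ) s

lemma abs_aeval_eq (p : ℤ[X]) (θ : ℝ) :
    |aeval θ p| = |(p.leadingCoeff : ℝ)| *
      (((p.map (Int.castRingHom ℂ)).roots.map fun α => ‖(θ : ℂ) - α‖).prod) := by
  rw [abs_aeval_eq_norm, (IsAlgClosed.splits (p.map (Int.castRingHom ℂ))).eval_eq_prod_roots,
    leadingCoeff_map_of_injective (RingHom.injective_int _), norm_mul, norm_multiset_prod,
    Multiset.map_map]
  simp

lemma resultantProduct_zero_left (g : ℤ[X]) : resultantProduct 0 g = 0 := by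
  simp [resultantProduct]

lemma resultantProduct_zero_right (f : ℤ[X]) : resultantProduct f 0 = 0 := by
  simp [resultantProduct]

lemma natDegree_resultantProduct_le (f g : ℤ[X]) :
    (resultantProduct f g).natDegree ≤ f.natDegree * g.natDegree := by
  rcases eq_or_ne f 0 with rfl | hf
  · simp [resultantProduct_zero_left]
  rcases eq_or_ne g 0 with rfl | hg
  · simp [resultantProduct_zero_right]
  rw [← natDegree_map_eq_of_injective (RingHom.injective_int (Int.castRingHom ℂ)),
    resultantProduct_spec hf hg, rootProduct]
  refine (natDegree_C_mul_le _ _).trans ((natDegree_multiset_prod_le _).trans ?_)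
  rw [Multiset.map_map]
  refine (Multiset.sum_le_card_nsmul _ g.natDegree fun x hx => ?_).trans ?_
  · obtain ⟨α, -, rfl⟩ := Multiset.mem_map.1 hx
    refine (natDegree_multiset_prod_le _).trans ?_
    rw [Multiset.map_map]
    refine (Multiset.sum_le_card_nsmul _ 1 fun x hx => ?_).trans ?_
    · obtain ⟨β, -, rfl⟩ := Multiset.mem_map.1 hx
      exact (natDegree_X_sub_C _).le
    · simp [card_roots_map_complex]
  · simp [card_roots_map_complex]

/-- The Mahler measure is multiplicative and `max 1 |αβ| ≤ max 1 |α| · max 1 |β|`; each root of one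
polynomial is paired with all roots of the other, whence the exponents. -/
lemma mahler_resultantProduct_le {f g : ℤ[X]} (hf : f ≠ 0) (hg : g ≠ 0) :
    mahler (resultantProduct f g) ≤ mahler f ^ g.natDegree * mahler g ^ f.natDegree := by
  have h1 : mahler (resultantProduct f g) =
      |(f.leadingCoeff : ℝ)| ^ g.natDegree * |(g.leadingCoeff : ℝ)| ^ f.natDegree *
        ((f.map (Int.castRingHom ℂ)).roots.map fun α =>
          ((g.map (Int.castRingHom ℂ)).roots.map fun β => max 1 ‖α * β‖).prod).prod := by
    rw [mahler, mapMahlerMeasure_eq, resultantProduct_spec hf hg, rootProduct, mahlerMeasure_mul,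
      mahlerMeasure_const, prod_mahlerMeasure_eq_mahlerMeasure_prod, Multiset.map_map]
    congr 1
    · simp
    · congr 2
      ext α
      simp only [Function.comp_apply]
      rw [prod_mahlerMeasure_eq_mahlerMeasure_prod, Multiset.map_map]
      simp only [Function.comp_apply, mahlerMeasure_X_sub_C]
  -- The trivial factors 1 give the shape required by `prod_prod_mul`.
  have h2 : ∀ α β : ℂ, max 1 ‖α * β‖ ≤ 1 * max 1 ‖α‖ * max 1 ‖β‖ * 1 := fun α β => by
    rw [one_mul, mul_one, norm_mul]
    exact max_le (one_le_mul_of_one_le_of_one_le (le_max_left _ _) (le_max_left _ _))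
      (mul_le_mul (le_max_right _ _) (le_max_right _ _) (norm_nonneg _) (by positivity))
  have h3 : ((f.map (Int.castRingHom ℂ)).roots.map fun α =>
          ((g.map (Int.castRingHom ℂ)).roots.map fun β => max 1 ‖α * β‖).prod).prod ≤
      ((f.map (Int.castRingHom ℂ)).roots.map fun α =>
          ((g.map (Int.castRingHom ℂ)).roots.map fun β =>
            1 * max 1 ‖α‖ * max 1 ‖β‖ * 1).prod).prod := by
    refine Multiset.prod_map_le_prod_map₀ _ _
      (fun α _ => Multiset.prod_nonneg fun z hz => ?_) fun α _ =>
      Multiset.prod_map_le_prod_map₀ _ _ (fun β _ => by positivity) fun β _ => h2 α β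
    obtain ⟨β, -, rfl⟩ := Multiset.mem_map.1 hz
    positivity
  rw [h1, mahler_eq f, mahler_eq g]
  refine (mul_le_mul_of_nonneg_left h3 (by positivity)).trans (le_of_eq ?_)
  rw [prod_prod_mul _ _ 1 (fun α => max 1 ‖α‖) (fun β => max 1 ‖β‖) fun _ _ => 1]
  simp only [card_roots_map_complex, one_pow, one_mul, Multiset.map_const', Multiset.prod_replicate,
    mul_one, mul_pow]
  ring

lemma natAbs_coeff_le_height (p : ℤ[X]) (i : ℕ) : (p.coeff i).natAbs ≤ height p := by
  by_cases h : i ∈ p.support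
  · exact Finset.le_sup (f := fun i => (p.coeff i).natAbs) h
  · simp [notMem_support_iff.1 h]

lemma height_pos {p : ℤ[X]} (hp : p ≠ 0) : 0 < height p :=
  (Int.natAbs_pos.2 (leadingCoeff_ne_zero.2 hp)).trans_le (natAbs_coeff_le_height p p.natDegree)

lemma height_eq_supNorm (p : ℤ[X]) :
    (height p : ℝ) = (p.map (Int.castRingHom ℂ)).supNorm := by
  have hc : ∀ i, ‖(p.map (Int.castRingHom ℂ)).coeff i‖ = ((p.coeff i).natAbs : ℝ) := fun i => by
    simp [Nat.cast_natAbs]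
  refine le_antisymm ?_ ?_
  · rcases eq_or_ne p 0 with rfl | hp
    · simp [height]
    · obtain ⟨i, -, hi⟩ := Finset.exists_mem_eq_sup p.support (nonempty_support_iff.2 hp)
        fun i => (p.coeff i).natAbs
      rw [height, hi, ← hc]
      exact le_supNorm _ i
  · obtain ⟨i, hi⟩ := (p.map (Int.castRingHom ℂ)).exists_eq_supNorm
    rw [hi, hc]
    exact_mod_cast natAbs_coeff_le_height p i

lemma height_le_two_pow_mul_mahler (p : ℤ[X]) :
    (height p : ℝ) ≤ 2 ^ p.natDegree * mahler p := by
  rw [height_eq_supNorm]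
  refine (supNorm_le_choose_natDegree_div_two_mul_mahlerMeasure _).trans ?_
  rw [natDegree_map_eq_of_injective (RingHom.injective_int _)]
  refine mul_le_mul_of_nonneg_right ?_ (mahlerMeasure_nonneg _)
  exact_mod_cast Nat.choose_le_two_pow _ _

lemma mahler_le_two_pow_mul_height (p : ℤ[X]) :
    mahler p ≤ 2 ^ p.natDegree * (height p : ℝ) := by
  rw [height_eq_supNorm]
  refine (mahlerMeasure_le_sqrt_natDegree_add_one_mul_supNorm _).trans ?_
  rw [natDegree_map_eq_of_injective (RingHom.injective_int _)]
  refine mul_le_mul_of_nonneg_right ?_ (supNorm_nonneg _)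
  have h : ((p.natDegree : ℝ) + 1) ≤ 2 ^ p.natDegree := by
    exact_mod_cast Nat.lt_two_pow_self
  refine (Real.sqrt_le_sqrt h).trans ?_
  -- `√(2^n) ≤ 2^n` because `2^n ≤ (2^n)^2`.
  exact Real.sqrt_le_iff.2 ⟨by positivity, le_self_pow₀ (one_le_pow₀ one_le_two) two_ne_zero⟩

/-! ### The value of the resultant product -/

/-- With `c = 1 + |θ|` and `c' = 1 + |η|`, the two terms of `(θ - α)β + θ(η - β)` contribute `c` and
`c c'` to the constant, and `c(1 + c') = (1 + |θ|)(2 + |η|)`. The denominators are chosen to make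
both quotients at most 1, as `prod_prod_max_le` requires. -/
lemma norm_mul_sub_mul_le (θ η α β : ℂ) :
    ‖θ * η - α * β‖ ≤ ((1 + ‖θ‖) * (2 + ‖η‖)) * max 1 ‖α‖ * max 1 ‖β‖ *
      max (‖θ - α‖ / ((1 + ‖θ‖) * max 1 ‖α‖)) (‖η - β‖ / ((1 + ‖η‖) * max 1 ‖β‖)) := by
  set c := 1 + ‖θ‖ with hc
  set c' := 1 + ‖η‖ with hc'
  set u := max 1 ‖α‖ with hu
  set v := max 1 ‖β‖ with hv
  set A := ‖θ - α‖ / (c * u) with hA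
  set B := ‖η - β‖ / (c' * v) with hB
  have hc0 : 0 < c := by positivity
  have hc0' : 0 < c' := by positivity
  have hu1 : 1 ≤ u := le_max_left _ _
  have hv1 : 1 ≤ v := le_max_left _ _
  have hAe : ‖θ - α‖ = c * u * A := by rw [hA]; field_simp
  have hBe : ‖η - β‖ = c' * v * B := by rw [hB]; field_simp
  have hA0 : 0 ≤ A := by positivity
  have hB0 : 0 ≤ B := by positivity
  have hm0 : 0 ≤ max A B := hA0.trans (le_max_left _ _)
  have h1 : ‖θ * η - α * β‖ ≤ ‖θ - α‖ * ‖β‖ + ‖θ‖ * ‖η - β‖ := by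
    rw [← norm_mul, ← norm_mul]
    rw [show θ * η - α * β = (θ - α) * β + θ * (η - β) by ring]
    exact norm_add_le _ _
  have h2 : ‖θ - α‖ * ‖β‖ ≤ c * u * v * max A B := by
    rw [hAe]
    calc c * u * A * ‖β‖ ≤ c * u * max A B * v := by
          gcongr
          · exact le_max_left _ _
          · exact le_max_right _ _
      _ = _ := by ring
  have h3 : ‖θ‖ * ‖η - β‖ ≤ c * c' * u * v * max A B := by
    rw [hBe]
    calc ‖θ‖ * (c' * v * B) = ‖θ‖ * c' * 1 * v * B := by ring
      _ ≤ c * c' * u * v * max A B := by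
          gcongr
          · simp [hc]
          · exact le_max_right _ _
  calc _ ≤ _ := h1
    _ ≤ _ := add_le_add h2 h3
    _ = _ := by rw [hc']; ring

lemma norm_sub_div_le_one (θ α : ℂ) : ‖θ - α‖ / ((1 + ‖θ‖) * max 1 ‖α‖) ≤ 1 := by
  refine div_le_one_of_le₀ ?_ (by positivity)
  have h1 := le_max_left 1 ‖α‖
  have h2 := le_max_right 1 ‖α‖
  nlinarith [norm_sub_le θ α, norm_nonneg θ]

/-- The constant in the estimate of the value of a resultant product at `θ * η`. -/
noncomputable def resultantConst (θ η : ℝ) : ℝ := (1 + |θ|) * (2 + |η|)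

lemma one_le_resultantConst (θ η : ℝ) : 1 ≤ resultantConst θ η :=
  one_le_mul_of_one_le_of_one_le (by linarith [abs_nonneg θ]) (by linarith [abs_nonneg η])

lemma prod_div_le (s : Multiset ℂ) (θ : ℂ) :
    (s.map fun α => ‖θ - α‖ / ((1 + ‖θ‖) * max 1 ‖α‖)).prod ≤
      (s.map fun α => ‖θ - α‖).prod / (s.map fun α => max 1 ‖α‖).prod := by
  rw [← Multiset.prod_map_div]
  refine Multiset.prod_map_le_prod_map₀ _ _ (fun α _ => by positivity) fun α _ => ?_
  refine div_le_div_of_nonneg_left (norm_nonneg _) (by positivity) ?_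
  exact le_mul_of_one_le_left (by positivity) (by linarith [norm_nonneg θ])

/-- Numerator and denominator become `|f(θ)|` and `𝔪(f)` after multiplication by the same leading
coefficient. -/
lemma prod_div_prod_eq {p : ℤ[X]} (hp : p ≠ 0) (θ : ℝ) :
    ((p.map (Int.castRingHom ℂ)).roots.map fun α => ‖(θ : ℂ) - α‖).prod /
        ((p.map (Int.castRingHom ℂ)).roots.map fun α => max 1 ‖α‖).prod =
      |aeval θ p| / mahler p := by
  rw [abs_aeval_eq, mahler_eq, mul_div_mul_left]
  simpa using hp

theorem abs_aeval_resultantProduct_le {f g : ℤ[X]} (hf : f ≠ 0) (hg : g ≠ 0) (θ η : ℝ) :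
    |aeval (θ * η) (resultantProduct f g)| ≤
      resultantConst θ η ^ (f.natDegree * g.natDegree) * mahler f ^ g.natDegree *
        mahler g ^ f.natDegree * max (|aeval θ f| / mahler f) (|aeval η g| / mahler g) := by
  set s := (f.map (Int.castRingHom ℂ)).roots with hs
  set t := (g.map (Int.castRingHom ℂ)).roots with ht
  have h1 : |aeval (θ * η) (resultantProduct f g)| =
      |(f.leadingCoeff : ℝ)| ^ g.natDegree * |(g.leadingCoeff : ℝ)| ^ f.natDegree *
        (s.map fun α => (t.map fun β => ‖(θ : ℂ) * η - α * β‖).prod).prod := by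
    rw [abs_aeval_eq_norm, resultantProduct_spec hf hg, rootProduct]
    simp only [eval_mul, eval_C, eval_multiset_prod, Multiset.map_map, Function.comp_def, eval_sub,
      eval_X, norm_mul, norm_pow, norm_multiset_prod, Complex.norm_intCast, Complex.ofReal_mul,
      ← hs, ← ht]
  set A : ℂ → ℝ := fun α => ‖(θ : ℂ) - α‖ / ((1 + ‖(θ : ℂ)‖) * max 1 ‖α‖) with hA
  set B : ℂ → ℝ := fun β => ‖(η : ℂ) - β‖ / ((1 + ‖(η : ℂ)‖) * max 1 ‖β‖) with hB
  have h2 : (s.map fun α => (t.map fun β => ‖(θ : ℂ) * η - α * β‖).prod).prod ≤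
      (s.map fun α => (t.map fun β =>
        resultantConst θ η * max 1 ‖α‖ * max 1 ‖β‖ * max (A α) (B β)).prod).prod := by
    refine Multiset.prod_map_le_prod_map₀ _ _
      (fun α _ => Multiset.prod_nonneg fun z hz => ?_) fun α _ =>
      Multiset.prod_map_le_prod_map₀ _ _ (fun β _ => norm_nonneg _) fun β _ => ?_
    · obtain ⟨β, -, rfl⟩ := Multiset.mem_map.1 hz
      exact norm_nonneg _
    · simpa [resultantConst, hA, hB] using norm_mul_sub_mul_le θ η α β
  have h3 := prod_prod_max_le s t (A := A) (B := B) (fun _ => by positivity)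
    (fun α => norm_sub_div_le_one θ α) (fun _ => by positivity) fun β => norm_sub_div_le_one η β
  have h4 : max (s.map A).prod (t.map B).prod ≤
      max (|aeval θ f| / mahler f) (|aeval η g| / mahler g) := by
    rw [← prod_div_prod_eq hf, ← prod_div_prod_eq hg]
    exact max_le_max (prod_div_le s θ) (prod_div_le t η)
  have hK := zero_le_one.trans (one_le_resultantConst θ η)
  have hMf := zero_le_one.trans (one_le_mahler hf)
  have hMg := zero_le_one.trans (one_le_mahler hg)
  rw [h1]
  refine (mul_le_mul_of_nonneg_left h2 (by positivity)).trans ?_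
  refine le_trans (le_of_eq ?_) (mul_le_mul_of_nonneg_left (h3.trans h4) (by positivity))
  rw [prod_prod_mul, mahler_eq f, mahler_eq g, ← hs, ← ht, hs, ht, card_roots_map_complex,
    card_roots_map_complex]
  ring

/-! ### Degree-normalized estimates -/

/-- The division by `M` is what lowers the exponent of `M` from `1/D` to `1/D - 1/(DE) = (1/D)(1 -
1/E)`. -/
lemma rpow_normalized_eq {K M N x D E : ℝ} (hK : 0 < K) (hM : 0 < M) (hN : 0 < N) (hx : 0 ≤ x)
    (hD : 0 < D) (hE : 0 < E) :
    (K ^ (D * E) * M ^ E * N ^ D * (x / M)) ^ (D * E)⁻¹ =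
      K * ((M ^ D⁻¹) ^ (1 - E⁻¹) * N ^ E⁻¹ * (x ^ D⁻¹) ^ E⁻¹) := by
  rw [Real.mul_rpow (by positivity) (by positivity), Real.mul_rpow (by positivity) (by positivity),
    Real.mul_rpow (by positivity) (by positivity), Real.div_rpow hx hM.le,
    ← Real.rpow_mul hK.le, ← Real.rpow_mul hM.le, ← Real.rpow_mul hN.le, ← Real.rpow_mul hM.le,
    ← Real.rpow_mul hx, mul_inv_cancel₀ (by positivity), Real.rpow_one,
    show D⁻¹ * (1 - E⁻¹) = E * (D * E)⁻¹ - (D * E)⁻¹ by field_simp, Real.rpow_sub hM,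
    show D * (D * E)⁻¹ = E⁻¹ by field_simp, ← mul_inv]
  ring

lemma rpow_normalized_le {p K M N x y D E : ℝ} (hp : 0 ≤ p) (hK : 0 < K) (hM : 0 < M) (hN : 0 < N)
    (hx : 0 ≤ x) (hy : 0 ≤ y) (hD : 0 < D) (hE : 0 < E)
    (h : p ≤ K ^ (D * E) * M ^ E * N ^ D * max (x / M) (y / N)) :
    p ^ (D * E)⁻¹ ≤ K * max ((M ^ D⁻¹) ^ (1 - E⁻¹) * N ^ E⁻¹ * (x ^ D⁻¹) ^ E⁻¹)
      (M ^ D⁻¹ * (N ^ E⁻¹) ^ (1 - D⁻¹) * (y ^ E⁻¹) ^ D⁻¹) := by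
  refine (Real.rpow_le_rpow hp h (by positivity)).trans ?_
  rcases max_choice (x / M) (y / N) with h | h <;> rw [h]
  · rw [rpow_normalized_eq hK hM hN hx hD hE]
    exact mul_le_mul_of_nonneg_left (le_max_left _ _) hK.le
  · rw [mul_comm D E, mul_right_comm (K ^ (E * D)), rpow_normalized_eq hK hN hM hy hE hD]
    refine mul_le_mul_of_nonneg_left (le_trans (le_of_eq ?_) (le_max_right _ _)) hK.le
    ring

theorem abs_aeval_resultantProduct_rpow_le (f g : ℤ[X]) (θ η : ℝ) {d e : ℕ+}
    (hd : f.natDegree ≤ d) (he : g.natDegree ≤ e) :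
    |aeval (θ * η) (resultantProduct f g)| ^ ((d : ℝ) * (e : ℝ))⁻¹ ≤ resultantConst θ η *
      max ((mahler f ^ (d : ℝ)⁻¹) ^ (1 - (e : ℝ)⁻¹) * mahler g ^ (e : ℝ)⁻¹ *
          (|aeval θ f| ^ (d : ℝ)⁻¹) ^ (e : ℝ)⁻¹)
        (mahler f ^ (d : ℝ)⁻¹ * (mahler g ^ (e : ℝ)⁻¹) ^ (1 - (d : ℝ)⁻¹) *
          (|aeval η g| ^ (e : ℝ)⁻¹) ^ (d : ℝ)⁻¹) := by
  have hd0 : (0 : ℝ) < d := by exact_mod_cast d.pos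
  have he0 : (0 : ℝ) < e := by exact_mod_cast e.pos
  have hK := one_le_resultantConst θ η
  have hK0 := zero_lt_one.trans_le hK
  by_cases h : f = 0 ∨ g = 0
  · have h0 : resultantProduct f g = 0 := by simp [resultantProduct, h]
    rw [h0, map_zero, abs_zero, Real.zero_rpow (by positivity)]
    have := mapMahlerMeasure_nonneg f (Int.castRingHom ℂ)
    have := mapMahlerMeasure_nonneg g (Int.castRingHom ℂ)
    exact mul_nonneg hK0.le ((by positivity : (0 : ℝ) ≤ _).trans (le_max_left _ _))
  · push Not at h
    have hf := one_le_mahler h.1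
    have hg := one_le_mahler h.2
    have hf0 := zero_lt_one.trans_le hf
    have hg0 := zero_lt_one.trans_le hg
    refine rpow_normalized_le (abs_nonneg _) hK0 hf0 hg0 (abs_nonneg _) (abs_nonneg _) hd0 he0
      ((abs_aeval_resultantProduct_le h.1 h.2 θ η).trans ?_)
    -- All three bases are at least 1, so degrees may be replaced by their upper bounds.
    have h1 : resultantConst θ η ^ (f.natDegree * g.natDegree) ≤
        resultantConst θ η ^ ((d : ℝ) * e) := by
      rw [← Real.rpow_natCast]
      exact Real.rpow_le_rpow_of_exponent_le hK (by exact_mod_cast Nat.mul_le_mul hd he)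
    have h2 : mahler f ^ g.natDegree ≤ mahler f ^ (e : ℝ) := by
      rw [← Real.rpow_natCast]
      exact Real.rpow_le_rpow_of_exponent_le hf (by exact_mod_cast he)
    have h3 : mahler g ^ f.natDegree ≤ mahler g ^ (d : ℝ) := by
      rw [← Real.rpow_natCast]
      exact Real.rpow_le_rpow_of_exponent_le hg (by exact_mod_cast hd)
    gcongr

lemma mahler_rpow_le (f : ℤ[X]) {d : ℕ+} (hd : f.natDegree ≤ d) :
    mahler f ^ (d : ℝ)⁻¹ ≤ 2 * (height f : ℝ) ^ (d : ℝ)⁻¹ := by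
  have hd0 : (0 : ℝ) < d := by exact_mod_cast d.pos
  have h : mahler f ≤ 2 ^ (d : ℝ) * (height f : ℝ) := by
    refine (mahler_le_two_pow_mul_height f).trans
      (mul_le_mul_of_nonneg_right ?_ (Nat.cast_nonneg _))
    rw [Real.rpow_natCast]
    exact pow_le_pow_right₀ one_le_two hd
  refine (Real.rpow_le_rpow (mapMahlerMeasure_nonneg _ _) h (by positivity)).trans (le_of_eq ?_)
  rw [Real.mul_rpow (by positivity) (by positivity), ← Real.rpow_mul zero_le_two,
    mul_inv_cancel₀ hd0.ne', Real.rpow_one]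

lemma height_resultantProduct_rpow_le (f g : ℤ[X]) {d e : ℕ+}
    (hd : f.natDegree ≤ d) (he : g.natDegree ≤ e) :
    (height (resultantProduct f g) : ℝ) ^ ((d : ℝ) * (e : ℝ))⁻¹ ≤
      2 * (mahler f ^ (d : ℝ)⁻¹ * mahler g ^ (e : ℝ)⁻¹) := by
  have hd0 : (0 : ℝ) < d := by exact_mod_cast d.pos
  have he0 : (0 : ℝ) < e := by exact_mod_cast e.pos
  by_cases h : f = 0 ∨ g = 0
  · have h0 : resultantProduct f g = 0 := by simp [resultantProduct, h]
    have := mapMahlerMeasure_nonneg f (Int.castRingHom ℂ)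
    have := mapMahlerMeasure_nonneg g (Int.castRingHom ℂ)
    rw [h0, height, support_zero, Finset.sup_empty, bot_eq_zero, Nat.cast_zero,
      Real.zero_rpow (by positivity)]
    positivity
  · push Not at h
    have hf := one_le_mahler h.1
    have hg := one_le_mahler h.2
    have hf0 := zero_lt_one.trans_le hf
    have hg0 := zero_lt_one.trans_le hg
    have h1 : (height (resultantProduct f g) : ℝ) ≤
        2 ^ ((d : ℝ) * e) * (mahler f ^ (e : ℝ) * mahler g ^ (d : ℝ)) := by
      refine (height_le_two_pow_mul_mahler _).trans (mul_le_mul ?_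
        ((mahler_resultantProduct_le h.1 h.2).trans (mul_le_mul ?_ ?_ (by positivity)
          (by positivity))) (mapMahlerMeasure_nonneg _ _) (by positivity))
      · rw [← Real.rpow_natCast]
        exact Real.rpow_le_rpow_of_exponent_le one_le_two (by
          exact_mod_cast (natDegree_resultantProduct_le f g).trans (Nat.mul_le_mul hd he))
      · rw [← Real.rpow_natCast]
        exact Real.rpow_le_rpow_of_exponent_le hf (by exact_mod_cast he)
      · rw [← Real.rpow_natCast]
        exact Real.rpow_le_rpow_of_exponent_le hg (by exact_mod_cast hd)
    refine (Real.rpow_le_rpow (by positivity) h1 (by positivity)).trans (le_of_eq ?_)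
    rw [Real.mul_rpow (by positivity) (by positivity), Real.mul_rpow (by positivity) (by positivity),
      ← Real.rpow_mul zero_le_two, ← Real.rpow_mul hf0.le, ← Real.rpow_mul hg0.le,
      mul_inv_cancel₀ (by positivity), Real.rpow_one,
      show (e : ℝ) * ((d : ℝ) * e)⁻¹ = (d : ℝ)⁻¹ by field_simp,
      show (d : ℝ) * ((d : ℝ) * e)⁻¹ = (e : ℝ)⁻¹ by field_simp]

/-! ### Classes of hyperreals -/

section Classes

variable {U : Ultrafilter ℕ}

lemma std_mul (a b : ℝ) : std U (a * b) = std U a * std U b := rfl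

lemma cls_mul (x y : Hyper U) : cls (x * y) = cls x * cls y := map_mul _ x y

/-- The quotient `x / y` is finite, and the valuation of a finite hyperreal is at most 1. -/
lemma cls_le_of_abs_le {x y : Hyper U} (C : ℝ) (h : |x| ≤ std U C * |y|) : cls x ≤ cls y := by
  rcases eq_or_ne y 0 with rfl | hy
  · rw [abs_zero, mul_zero, abs_nonpos_iff] at h
    rw [h]
  · refine ((finiteHyper U).valuation_le_iff x y).2 ⟨⟨x / y, C, ?_⟩, div_mul_cancel₀ x hy⟩
    rw [abs_div]
    exact (div_le_iff₀ (abs_pos.2 hy)).2 h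

lemma cls_le_max_of_abs_le {x y z : Hyper U} (C : ℝ) (h : |x| ≤ std U C * max |y| |z|) :
    cls x ≤ max (cls y) (cls z) := by
  rcases max_choice |y| |z| with h' | h' <;> rw [h'] at h
  · exact (cls_le_of_abs_le C h).trans (le_max_left _ _)
  · exact (cls_le_of_abs_le C h).trans (le_max_right _ _)

lemma isInfinitesimal_of_cls_lt_one {x : Hyper U} (h : cls x < 1) : IsInfinitesimal x := by
  intro ε hε
  by_contra! hx
  refine h.not_ge ?_
  rw [show (1 : GrowthDecay U) = cls 1 from (map_one _).symm]
  -- If `|x| ≥ ε`, then `1 ≤ ε⁻¹ |x|`, so the class of `x` is at least 1.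
  refine cls_le_of_abs_le ε⁻¹ ?_
  have hε' : std U ε⁻¹ * std U ε = 1 := by
    rw [← std_mul, inv_mul_cancel₀ hε.ne']
    rfl
  rw [abs_one, ← hε']
  exact mul_le_mul_of_nonneg_left hx (std_le_std (inv_pos.2 hε).le)

lemma cls_surjective : Function.Surjective (cls : Hyper U → GrowthDecay U) :=
  (finiteHyper U).valuation_surjective

lemma GrowthDecay.mul_pow (μ ν : GrowthDecay U) (r : Exponent U) :
    GrowthDecay.pow (μ * ν) r = GrowthDecay.pow μ r * GrowthDecay.pow ν r := by
  obtain ⟨x, rfl⟩ := cls_surjective μ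
  obtain ⟨y, rfl⟩ := cls_surjective ν
  rw [← cls_mul, cls_pow, cls_pow, cls_pow, hpow_mul, cls_mul]

lemma GrowthDecay.pow_le_one {μ : GrowthDecay U} (h : μ ≤ 1) (r : Exponent U) :
    GrowthDecay.pow μ r ≤ 1 := by
  obtain ⟨x, rfl⟩ := cls_surjective μ
  rw [cls_pow]
  exact ((finiteHyper U).valuation_le_one_iff _).2
    (hpow_isFinite (((finiteHyper U).valuation_le_one_iff _).1 h) r)

/-- Taking a `d`-th root does not decrease a number in `[0, 1]`, and keeps numbers at least 1 above
1; this is uniform in `d`, so infinite `d` is allowed. -/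
lemma IsInfinitesimal.of_hpow_recip {x : Hyper U} {d : HyperDeg U}
    (h : IsInfinitesimal (hpow x (recip d))) : IsInfinitesimal x := by
  intro ε hε
  -- The bound by 1 excludes `|x i| ≥ 1`, whose root can be arbitrarily close to 1.
  have h1 := h (min ε 1) (by positivity)
  induction x using Germ.inductionOn with | _ x
  induction d using Germ.inductionOn with | _ d
  refine Germ.coe_lt.2 ?_
  filter_upwards [Germ.coe_lt.1 h1] with i hi
  change |(|x i| ^ ((d i : ℕ) : ℝ)⁻¹)| < min ε 1 at hi
  change |x i| < ε
  rw [abs_of_nonneg (by positivity)] at hi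
  by_contra! hx
  have hd0 : (0 : ℝ) < ((d i : ℕ) : ℝ) := by exact_mod_cast (d i).pos
  have hd1 : ((d i : ℕ) : ℝ)⁻¹ ≤ 1 := inv_le_one_of_one_le₀ (by exact_mod_cast (d i).pos)
  rcases le_total |x i| 1 with h2 | h2
  · have := Real.rpow_le_rpow_of_exponent_ge' (abs_nonneg (x i)) h2 (by positivity) hd1
    rw [Real.rpow_one] at this
    exact (hx.trans this).not_gt (hi.trans_le (min_le_left _ _))
  · exact (Real.one_le_rpow h2 (by positivity)).not_gt (hi.trans_le (min_le_right _ _))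

end Classes

/-! ### The resultant product of hyperpolynomials -/

section ResultantProduct

variable {U : Ultrafilter ℕ}

lemma hyperResultantProduct_zero_left (g : HyperPoly U) : hyperResultantProduct 0 g = 0 := by
  induction g using Germ.inductionOn with | _ g
  exact Germ.coe_eq.2 (Eventually.of_forall fun i => resultantProduct_zero_left _)

lemma hyperResultantProduct_zero_right (f : HyperPoly U) : hyperResultantProduct f 0 = 0 := by
  induction f using Germ.inductionOn with | _ f
  exact Germ.coe_eq.2 (Eventually.of_forall fun i => resultantProduct_zero_right _)

lemma degLE_hyperResultantProduct {f g : HyperPoly U} {d e : HyperDeg U} (hf : DegLE f d)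
    (hg : DegLE g e) : DegLE (hyperResultantProduct f g) (d * e) := by
  induction f using Germ.inductionOn with | _ f
  induction g using Germ.inductionOn with | _ g
  induction d using Germ.inductionOn with | _ d
  induction e using Germ.inductionOn with | _ e
  refine Germ.coe_le.2 ?_
  filter_upwards [Germ.coe_le.1 hf, Germ.coe_le.1 hg] with i hi hi'
  exact (natDegree_resultantProduct_le _ _).trans (Nat.mul_le_mul hi hi')

theorem decay_hyperResultantProduct_le {f g : HyperPoly U} {d e : HyperDeg U} (hf : DegLE f d)
    (hg : DegLE g e) (θ η : ℝ) :
    decay (θ * η) (d * e) (hyperResultantProduct f g) ≤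
      max
        (cls (hpow (normMahler d f) (oneSubInvExp e).1 * normMahler e g) *
          GrowthDecay.pow (decay θ d f) (invExp e))
        (cls (normMahler d f * hpow (normMahler e g) (oneSubInvExp d).1) *
          GrowthDecay.pow (decay η e g) (invExp d)) := by
  unfold decay
  rw [cls_pow, cls_pow, ← cls_mul, ← cls_mul]
  -- The constant is independent of the index `i` of the ultrapower, so the termwise estimate passes
  -- to classes.
  refine cls_le_max_of_abs_le (resultantConst θ η) ?_
  induction f using Germ.inductionOn with | _ f
  induction g using Germ.inductionOn with | _ g
  induction d using Germ.inductionOn with | _ d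
  induction e using Germ.inductionOn with | _ e
  rw [Germ.max_def]
  refine Germ.coe_le.2 ?_
  filter_upwards [Germ.coe_le.1 hf, Germ.coe_le.1 hg] with i hi hi'
  have h := abs_aeval_resultantProduct_rpow_le (f i) (g i) θ η hi hi'
  have hM := mapMahlerMeasure_nonneg (f i) (Int.castRingHom ℂ)
  have hN := mapMahlerMeasure_nonneg (g i) (Int.castRingHom ℂ)
  change |(|aeval (θ * η) (resultantProduct (f i) (g i))| ^ (((d i * e i : ℕ+) : ℕ) : ℝ)⁻¹)| ≤
    resultantConst θ η *
      max |(|(|mahler (f i)| ^ ((d i : ℕ) : ℝ)⁻¹)| ^ (1 - ((e i : ℕ) : ℝ)⁻¹) *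
          |mahler (g i)| ^ ((e i : ℕ) : ℝ)⁻¹ *
          |(|aeval θ (f i)| ^ ((d i : ℕ) : ℝ)⁻¹)| ^ ((e i : ℕ) : ℝ)⁻¹)|
        |(|mahler (f i)| ^ ((d i : ℕ) : ℝ)⁻¹ *
          |(|mahler (g i)| ^ ((e i : ℕ) : ℝ)⁻¹)| ^ (1 - ((d i : ℕ) : ℝ)⁻¹) *
          |(|aeval η (g i)| ^ ((e i : ℕ) : ℝ)⁻¹)| ^ ((d i : ℕ) : ℝ)⁻¹)|
  have e1 : ∀ x y : ℝ, |(|x| ^ y)| = |x| ^ y := fun x y =>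
    abs_of_nonneg (Real.rpow_nonneg (abs_nonneg _) _)
  simp only [abs_mul, e1]
  rw [abs_of_nonneg hM, abs_of_nonneg hN, PNat.mul_coe, Nat.cast_mul]
  have e2 : ∀ {x y z : ℝ}, 0 ≤ x → |(x ^ y) ^ z| = (x ^ y) ^ z := fun hx =>
    abs_of_nonneg (Real.rpow_nonneg (Real.rpow_nonneg hx _) _)
  rwa [e2 hM, e2 hN, e2 (abs_nonneg _), e2 (abs_nonneg _)]

lemma cls_normMahler_le {f : HyperPoly U} {d : HyperDeg U} (hf : DegLE f d) :
    cls (normMahler d f) ≤ cls (normHeight d f) := by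
  refine cls_le_of_abs_le 2 ?_
  induction f using Germ.inductionOn with | _ f
  induction d using Germ.inductionOn with | _ d
  refine Germ.coe_le.2 ?_
  filter_upwards [Germ.coe_le.1 hf] with i hi
  have h := mahler_rpow_le (f i) hi
  change |(|mahler (f i)| ^ ((d i : ℕ) : ℝ)⁻¹)| ≤
    2 * |(|(height (f i) : ℝ)| ^ ((d i : ℕ) : ℝ)⁻¹)|
  have hM := mapMahlerMeasure_nonneg (f i) (Int.castRingHom ℂ)
  rwa [abs_of_nonneg hM, Nat.abs_cast, abs_of_nonneg (Real.rpow_nonneg hM _),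
    abs_of_nonneg (Real.rpow_nonneg (Nat.cast_nonneg _) _)]

lemma cls_normHeight_hyperResultantProduct_le {f g : HyperPoly U} {d e : HyperDeg U}
    (hf : DegLE f d) (hg : DegLE g e) :
    cls (normHeight (d * e) (hyperResultantProduct f g)) ≤
      cls (normMahler d f) * cls (normMahler e g) := by
  rw [← cls_mul]
  refine cls_le_of_abs_le 2 ?_
  induction f using Germ.inductionOn with | _ f
  induction g using Germ.inductionOn with | _ g
  induction d using Germ.inductionOn with | _ d
  induction e using Germ.inductionOn with | _ e
  refine Germ.coe_le.2 ?_
  filter_upwards [Germ.coe_le.1 hf, Germ.coe_le.1 hg] with i hi hi'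
  have h := height_resultantProduct_rpow_le (f i) (g i) hi hi'
  change |(|(height (resultantProduct (f i) (g i)) : ℝ)| ^ (((d i * e i : ℕ+) : ℕ) : ℝ)⁻¹)| ≤
    2 * |(|mahler (f i)| ^ ((d i : ℕ) : ℝ)⁻¹ * |mahler (g i)| ^ ((e i : ℕ) : ℝ)⁻¹)|
  have hM := mapMahlerMeasure_nonneg (f i) (Int.castRingHom ℂ)
  have hN := mapMahlerMeasure_nonneg (g i) (Int.castRingHom ℂ)
  rwa [abs_of_nonneg hM, abs_of_nonneg hN, Nat.abs_cast,
    abs_of_nonneg (Real.rpow_nonneg (Nat.cast_nonneg _) _),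
    abs_of_nonneg (mul_nonneg (Real.rpow_nonneg hM _) (Real.rpow_nonneg hN _)), PNat.mul_coe,
    Nat.cast_mul]

lemma normHeight_ne_zero {f : HyperPoly U} (hf : f ≠ 0) (d : HyperDeg U) :
    normHeight d f ≠ 0 := by
  induction f using Germ.inductionOn with | _ f
  induction d using Germ.inductionOn with | _ d
  contrapose! hf
  refine Germ.coe_eq.2 ?_
  filter_upwards [Germ.coe_eq.1 hf] with i hi
  change |(height (f i) : ℝ)| ^ ((d i : ℕ) : ℝ)⁻¹ = 0 at hi
  by_contra h
  have : (0 : ℝ) < height (f i) := by exact_mod_cast height_pos h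
  exact (Real.rpow_pos_of_pos (abs_pos.2 this.ne') _).ne' hi

lemma lt_cls_inv_iff {x : Hyper U} (hx : x ≠ 0) {μ : GrowthDecay U} :
    μ < cls x⁻¹ ↔ μ * cls x < 1 := by
  have h0 : cls x ≠ 0 := (Valuation.ne_zero_iff _).2 hx
  rw [show cls x⁻¹ = (cls x)⁻¹ from map_inv₀ _ x, ← one_mul (cls x)⁻¹,
    lt_mul_inv_iff₀ (zero_lt_iff.2 h0)]

/-- The growth condition in the form used below: inversion is removed and the height is replaced by
the Mahler measure, whose class is no larger. -/
lemma mul_cls_normMahler_lt_one {f : HyperPoly U} {d : HyperDeg U} {μ : GrowthDecay U}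
    (hf0 : f ≠ 0) (hf : DegLE f d) (h : μ < growth d f) : cls (normMahler d f) * μ < 1 := by
  rw [mul_comm]
  exact (mul_le_mul_right (cls_normMahler_le hf) μ).trans_lt
    ((lt_cls_inv_iff (normHeight_ne_zero hf0 d)).1 h)

end ResultantProduct

end Ideology

theorem theorem14 (U : Ultrafilter ℕ) (hU : (U : Filter ℕ) ≤ Filter.cofinite)
    (θ η : ℝ) (d e : HyperDeg U) :
    (∀ f ∈ approx U θ d, ∀ g ∈ approx U η e,
      decay (θ * η) (d * e) (hyperResultantProduct f g) ≤
        max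
          (cls (hpow (normMahler d f) (oneSubInvExp e).1 * normMahler e g) *
            GrowthDecay.pow (decay θ d f) (invExp e))
          (cls (normMahler d f * hpow (normMahler e g) (oneSubInvExp d).1) *
            GrowthDecay.pow (decay η e g) (invExp d))) ∧
    (∀ μ ∈ decaySemiring U, ∀ ν ∈ decaySemiring U,
      ∀ f ∈ growthDecaySet θ d μ (GrowthDecay.pow μ (oneSubInvExp e) * ν) e,
      ∀ g ∈ growthDecaySet η e ν (μ * GrowthDecay.pow ν (oneSubInvExp d)) d,
        hyperResultantProduct f g ∈ growthSet (θ * η) (d * e) (μ * ν)) := by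
  refine ⟨fun f hf g hg => decay_hyperResultantProduct_le hf.1 hg.1 θ η, ?_⟩
  rintro μ - ν - f ⟨⟨hf, hfμ⟩, hfd⟩ g ⟨⟨hg, hgν⟩, hgd⟩
  have hdeg := degLE_hyperResultantProduct hf.1 hg.1
  -- The zero hyperpolynomial belongs to the target by convention, but its growth is not meaningful.
  by_cases h0 : hyperResultantProduct f g = 0
  · refine ⟨⟨hdeg, fun ε hε => ?_⟩, Or.inl h0⟩
    rw [h0, show hyperEval (θ * η) (0 : HyperPoly U) = 0 from
      congrArg (fun x : ℝ => (x : Hyper U)) (map_zero (aeval (θ * η))), abs_zero]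
    exact Germ.const_lt hε
  have hf0 : f ≠ 0 := fun h => h0 (by rw [h, hyperResultantProduct_zero_left])
  have hg0 : g ≠ 0 := fun h => h0 (by rw [h, hyperResultantProduct_zero_right])
  have hM := mul_cls_normMahler_lt_one hf0 hf.1 (hfμ.resolve_left hf0)
  have hN := mul_cls_normMahler_lt_one hg0 hg.1 (hgν.resolve_left hg0)
  refine ⟨⟨hdeg, IsInfinitesimal.of_hpow_recip (d := d * e) (isInfinitesimal_of_cls_lt_one ?_)⟩,
    Or.inr ((lt_cls_inv_iff (normHeight_ne_zero h0 _)).2 ?_)⟩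
  · refine (decay_hyperResultantProduct_le hf.1 hg.1 θ η).trans_lt (max_lt ?_ ?_)
    · refine (mul_le_mul_right hfd _).trans_lt ?_
      -- The bound regroups as `(𝔪_d(f)·μ)^(1-1/e) · (𝔪_e(g)·ν)`. The exponent vanishes when `e =
      -- 1`, so the first factor is only known to be at most 1; strictness comes from the second.
      rw [cls_mul, ← cls_pow, mul_mul_mul_comm, ← GrowthDecay.mul_pow]
      exact Right.mul_lt_one_of_le_of_lt (GrowthDecay.pow_le_one hM.le _) hN
    · refine (mul_le_mul_right hgd _).trans_lt ?_
      rw [cls_mul, ← cls_pow, mul_mul_mul_comm, ← GrowthDecay.mul_pow]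
      exact mul_lt_one_of_lt_of_le hM (GrowthDecay.pow_le_one hN.le _)
  -- Growth above `μ·ν` means that `μ·ν` times the class of the normalized height is below 1; this
  -- product is at most `(𝔪_d(f)·μ)(𝔪_e(g)·ν)`.
  · refine (mul_le_mul_right (cls_normHeight_hyperResultantProduct_le hf.1 hg.1) _).trans_lt ?_
    rw [mul_mul_mul_comm, mul_comm μ, mul_comm ν]
    exact mul_lt_one_of_lt_of_le hM hN.le
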